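/- Let $p\in(0,1)$. Let $Y_1,Y_2,\dots$ be a Markov chain with values in the four unit vectors $\{\pm e_1,\pm e_2\}$ of $\mathbb{Z}^2$ such that $Y_1$ is uniformly distributed on these vectors and, for every $n\ge 2$, given $Y_1,\dots,Y_{n-1}$, with probability $1-p$ one has $Y_n=Y_{n-1}$ and with probability $p$ the vector $Y_n$ is chosen afresh, uniformly among the four unit vectors; that is, the transition matrix is $(1-p)I+\frac p4 A$, where $I$ is the $4\times 4$ identity matrix and $A$ is the $4\times4$ matrix all of whose entries are $1$. Let $S_0=(0,0)$ and $S_n=Y_1+\dots+Y_n$ for $n\ge1$ (the conservative random walk on $\mathbb{Z}^2$ with constant update probabilities $p_n=p$, $n\ge2$). Then $S$ is recurrent: almost surely, $S_n=(0,0)$ for infinitely many $n$. -/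

import Mathlib

open MeasureTheory Filter

noncomputable section

/-- The `2d` coordinate directions of `ℤ^d`: `(i, true)` stands for `+e_i` and `(i, false)`
for `-e_i`. -/
abbrev Direction (d : ℕ) : Type := Fin d × Bool

/-- The unit vector `±e_i` of `ℤ^d` belonging to a direction. -/
def Direction.toVec {d : ℕ} (v : Direction d) : Fin d → ℤ :=
  Pi.single v.1 (if v.2 then 1 else -1)

/-- The `2d × 2d` transition matrix `(1 - a) I + (a / (2d)) A` on the directions, where `A` is
the matrix of ones: with probability `a` the direction is chosen afresh, uniformly among all
`2d` directions, and otherwise it is kept. -/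
def transitionMatrix (d : ℕ) (a : ℝ) : Matrix (Direction d) (Direction d) ℝ :=
  (1 - a) • (1 : Matrix (Direction d) (Direction d) ℝ) +
    (a / (2 * d)) • Matrix.of (fun _ _ => (1 : ℝ))

/-- `Y 1, Y 2, …` is the sequence of steps of the conservative random walk on `ℤ^d` with update
probabilities `p 2, p 3, …`: an inhomogeneous Markov chain on the `2d` directions, uniformly
distributed at time `1`, whose transition matrix from time `n` to time `n + 1` is
`(1 - p (n+1)) I + (p (n+1) / (2d)) A`. The values `Y 0`, `p 0`, `p 1` play no role. -/
structure IsConservativeStepChain {Ω : Type*} [MeasurableSpace Ω] {d : ℕ} (p : ℕ → ℝ)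
    (μ : Measure Ω) (Y : ℕ → Ω → Direction d) : Prop where
  measurable : ∀ n, 1 ≤ n → Measurable (Y n)
  initial : ∀ v : Direction d, μ.real {ω | Y 1 ω = v} = 1 / (2 * d)
  markov : ∀ n, 1 ≤ n → ∀ v : ℕ → Direction d,
    μ.real {ω | ∀ i ∈ Finset.Icc 1 (n + 1), Y i ω = v i} =
      μ.real {ω | ∀ i ∈ Finset.Icc 1 n, Y i ω = v i} *
        transitionMatrix d (p (n + 1)) (v n) (v (n + 1))

/-- The walk `S_n = z + Y_1 + … + Y_n` on `ℤ^d`. -/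
def conservativeWalk {Ω : Type*} {d : ℕ} (z : Fin d → ℤ) (Y : ℕ → Ω → Direction d)
    (n : ℕ) (ω : Ω) : Fin d → ℤ :=
  z + ∑ i ∈ Finset.Icc 1 n, (Y i ω).toVec

/-- Almost surely, `S_n = 0` for infinitely many `n`. -/
def IsRecurrentWalk {Ω : Type*} [MeasurableSpace Ω] {d : ℕ} (μ : Measure Ω)
    (S : ℕ → Ω → Fin d → ℤ) : Prop :=
  ∀ᵐ ω ∂μ, ∃ᶠ n in atTop, S n ω = 0

end

/-! With probability `p` the direction is refreshed at time `n + 1`, and from then on the walk is an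
independent copy of itself. Hence a past event and an event of the next block jointly have at least
`p` times the product of their probabilities (`block_superproduct`). This replaces the renewal
property in both halves of the argument.

Lower bound on returns: the law of `S_n` is symmetric, so `P(S_{2n} = 0) ≥ p ∑ P(S_n = x)^2`.
Correlations of steps decay geometrically, so the second moment of each coordinate is at most
`2n/p`, and `S_n` lies with probability at least `1/2` in a box with `O(n)` points. By
Cauchy–Schwarz `P(S_{2n} = 0) ≥ c/n`, and the expected number of returns is infinite.

Recurrence: let `t` be the probability of no visit to the origin after time `m`. A visit at time `n`
with no visit in a long window starting beyond `n + m` has probability at least `p P(S_n = 0) t`,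
but at most `m + 1` such times occur on any path. So `t > 0` would make the expected number of
returns finite. -/

/-! ### Blocks of steps, reflection, transition matrix -/

section Paths

variable {Ω : Type*} {d : ℕ}

/-- The `k` steps `Y (n + 1), …, Y (n + k)` following time `n`. -/
def stepBlock (Y : ℕ → Ω → Direction d) (n k : ℕ) (ω : Ω) : Fin k → Direction d :=
  fun i => Y (n + i + 1) ω

/-- The sum of the first `j` vectors of a finite sequence of directions. -/
def partialSum {k : ℕ} (j : ℕ) (x : Fin k → Direction d) : Fin d → ℤ :=
  ∑ i : Fin k, if (i : ℕ) < j then (x i).toVec else 0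

theorem partialSum_stepBlock (Y : ℕ → Ω → Direction d) (n : ℕ) {j k : ℕ} (h : j ≤ k) (ω : Ω) :
    partialSum j (stepBlock Y n k ω) = ∑ i ∈ Finset.range j, (Y (n + i + 1) ω).toVec := by
  unfold partialSum stepBlock
  rw [Fin.sum_univ_eq_sum_range
    (fun i => if i < j then (Y (n + i + 1) ω).toVec else 0) k, ← Finset.sum_filter]
  congr 1
  ext i
  simp only [Finset.mem_filter, Finset.mem_range]
  omega

theorem conservativeWalk_zero_eq (Y : ℕ → Ω → Direction d) (n : ℕ) (ω : Ω) :
    conservativeWalk (0 : Fin d → ℤ) Y n ω = ∑ i ∈ Finset.range n, (Y (i + 1) ω).toVec := by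
  rw [conservativeWalk, zero_add, Finset.range_eq_Ico, Finset.sum_Ico_add' (fun i => (Y i ω).toVec)]
  rfl

theorem conservativeWalk_eq_partialSum (Y : ℕ → Ω → Direction d) {j k : ℕ} (h : j ≤ k) (ω : Ω) :
    conservativeWalk (0 : Fin d → ℤ) Y j ω = partialSum j (stepBlock Y 0 k ω) := by
  rw [partialSum_stepBlock Y 0 h, conservativeWalk_zero_eq]
  simp

theorem conservativeWalk_add (Y : ℕ → Ω → Direction d) (n : ℕ) {j k : ℕ} (h : j ≤ k) (ω : Ω) :
    conservativeWalk (0 : Fin d → ℤ) Y (n + j) ω =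
      conservativeWalk (0 : Fin d → ℤ) Y n ω + partialSum j (stepBlock Y n k ω) := by
  rw [partialSum_stepBlock Y n h, conservativeWalk_zero_eq, conservativeWalk_zero_eq,
    Finset.sum_range_add]

/-- Any two finite sequences are consecutive blocks of an infinite one. -/
theorem exists_eq_blocks {α : Type*} {n k : ℕ} (hk : 1 ≤ k) (x : Fin n → α) (y : Fin k → α) :
    ∃ v : ℕ → α, (x = fun i : Fin n => v (i + 1)) ∧ y = fun i : Fin k => v (n + i + 1) := by
  refine ⟨fun i => if h : i - 1 < n then x ⟨i - 1, h⟩ else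
    if h' : i - n - 1 < k then y ⟨i - n - 1, h'⟩ else y ⟨0, hk⟩, ?_, ?_⟩
  · ext i
    simp
  · ext i
    have h1 : ¬ (n + (i : ℕ) < n) := by omega
    have h2 : n + (i : ℕ) + 1 - n - 1 = i := by omega
    simp [h1, h2]

theorem setOf_stepBlock_eq (Y : ℕ → Ω → Direction d) (k : ℕ) (v : ℕ → Direction d) :
    {ω | stepBlock Y 0 k ω = fun i : Fin k => v (i + 1)} =
      {ω | ∀ i ∈ Finset.Icc 1 k, Y i ω = v i} := by
  ext ω
  simp only [Set.mem_ofPred_eq, funext_iff, stepBlock, Finset.mem_Icc, zero_add]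
  constructor
  · rintro h i ⟨h1, h2⟩
    have := h ⟨i - 1, by omega⟩
    simpa [Nat.sub_add_cancel h1] using this
  · intro h i
    exact h _ ⟨by omega, by omega⟩

theorem setOf_stepBlock_eq_and (Y : ℕ → Ω → Direction d) (n k : ℕ) (v : ℕ → Direction d) :
    {ω | stepBlock Y 0 n ω = (fun i : Fin n => v (i + 1)) ∧
        stepBlock Y n k ω = fun i : Fin k => v (n + i + 1)} =
      {ω | ∀ i ∈ Finset.Icc 1 (n + k), Y i ω = v i} := by
  ext ω
  simp only [Set.mem_ofPred_eq, funext_iff, stepBlock, Finset.mem_Icc, zero_add]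
  constructor
  · rintro ⟨h, h'⟩ i ⟨h1, h2⟩
    rcases le_or_gt i n with hi | hi
    · have := h ⟨i - 1, by omega⟩
      simpa [Nat.sub_add_cancel h1] using this
    · have := h' ⟨i - n - 1, by omega⟩
      have e : n + (i - n - 1) + 1 = i := by omega
      simpa only [e] using this
  · intro h
    exact ⟨fun i => h _ ⟨by omega, by omega⟩, fun i => h _ ⟨by omega, by omega⟩⟩

/-- The reflected direction. -/
def Direction.flip (v : Direction d) : Direction d := (v.1, !v.2)

theorem Direction.flip_flip (v : Direction d) : v.flip.flip = v := by
  simp [Direction.flip]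

theorem Direction.toVec_flip (v : Direction d) : v.flip.toVec = -v.toVec := by
  obtain ⟨i, b⟩ := v
  cases b <;> simp [Direction.flip, Direction.toVec, ← Pi.single_neg]

theorem Direction.sum_toVec_apply (i : Fin d) :
    ∑ v : Direction d, (v.toVec i : ℝ) = 0 := by
  rw [Fintype.sum_prod_type]
  refine Finset.sum_eq_zero fun j _ => ?_
  by_cases h : i = j
  · subst h; simp [Direction.toVec]
  · simp [Direction.toVec, h]

theorem Direction.toVec_apply_sq_le (v : Direction d) (i : Fin d) :
    (v.toVec i : ℝ) ^ 2 ≤ 1 := by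
  obtain ⟨j, b⟩ := v
  by_cases h : i = j
  · subst h; cases b <;> simp [Direction.toVec]
  · simp [Direction.toVec, h]

theorem partialSum_flip {k : ℕ} (j : ℕ) (x : Fin k → Direction d) :
    partialSum j (fun i => (x i).flip) = -partialSum j x := by
  simp only [partialSum, Direction.toVec_flip, ← Finset.sum_neg_distrib]
  refine Finset.sum_congr rfl fun i _ => ?_
  split_ifs <;> simp

theorem transitionMatrix_apply (a : ℝ) (u v : Direction d) :
    transitionMatrix d a u v = (1 - a) * (if u = v then 1 else 0) + a / (2 * d) := by
  simp [transitionMatrix, Matrix.one_apply]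

theorem transitionMatrix_flip (a : ℝ) (u v : Direction d) :
    transitionMatrix d a u.flip v.flip = transitionMatrix d a u v := by
  have : u.flip = v.flip ↔ u = v :=
    (Function.Involutive.injective Direction.flip_flip).eq_iff
  simp [transitionMatrix_apply, this]

/-- Only the refreshing part is kept. This bound, uniform in `u`, is what makes the future nearly
independent of the past. -/
theorem le_transitionMatrix {a : ℝ} (ha : a ≤ 1) (u v : Direction d) :
    a / (2 * d) ≤ transitionMatrix d a u v := by
  rw [transitionMatrix_apply]
  split_ifs <;> linarith

/-- The matrix of ones annihilates `g`, so only the multiple of the identity acts. -/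
theorem sum_transitionMatrix_mul (a : ℝ) (u : Direction d) (g : Direction d → ℝ)
    (hg : ∑ v, g v = 0) : ∑ v, transitionMatrix d a u v * g v = (1 - a) * g u := by
  simp [transitionMatrix_apply, add_mul, Finset.sum_add_distrib, ← Finset.mul_sum, hg]

end Paths

/-! ### Cylinder probabilities -/

section Chain

variable {Ω : Type*} [MeasurableSpace Ω] {d : ℕ} {μ : Measure Ω} {p : ℝ} {pseq : ℕ → ℝ}
  {Y : ℕ → Ω → Direction d}

theorem IsConservativeStepChain.measurable_stepBlock (hY : IsConservativeStepChain pseq μ Y)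
    (n k : ℕ) : Measurable (stepBlock Y n k) :=
  measurable_pi_lambda _ fun _ => hY.measurable _ (by omega)

theorem IsConservativeStepChain.measurable_walk (hY : IsConservativeStepChain pseq μ Y)
    (n : ℕ) : Measurable (conservativeWalk (0 : Fin d → ℤ) Y n) := by
  have : conservativeWalk (0 : Fin d → ℤ) Y n = partialSum n ∘ stepBlock Y 0 n :=
    funext fun ω => conservativeWalk_eq_partialSum Y le_rfl ω
  rw [this]
  exact (measurable_of_countable _).comp (hY.measurable_stepBlock 0 n)

theorem IsConservativeStepChain.cylinder_one (hY : IsConservativeStepChain pseq μ Y)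
    (v : ℕ → Direction d) :
    μ.real {ω | ∀ i ∈ Finset.Icc 1 1, Y i ω = v i} = 1 / (2 * d) := by
  simpa using hY.initial (v 1)

/-- Refreshing the direction at time `n + 1` makes the following steps an independent copy of
the chain. -/
theorem IsConservativeStepChain.cylinder_superproduct (hY : IsConservativeStepChain pseq μ Y)
    (hpseq : ∀ n, 2 ≤ n → pseq n = p) (hp0 : 0 ≤ p) (hp1 : p ≤ 1) {n k : ℕ} (hn : 1 ≤ n)
    (hk : 1 ≤ k) (v : ℕ → Direction d) :
    p * μ.real {ω | ∀ i ∈ Finset.Icc 1 n, Y i ω = v i} *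
        μ.real {ω | ∀ i ∈ Finset.Icc 1 k, Y i ω = v (n + i)} ≤
      μ.real {ω | ∀ i ∈ Finset.Icc 1 (n + k), Y i ω = v i} := by
  induction k, hk using Nat.le_induction with
  | base =>
    -- The initial law `1 / (2d)` times `p` is the refreshing part of the transition at time `n +
    -- 1`.
    rw [hY.cylinder_one (fun i => v (n + i)), hY.markov n hn, hpseq _ (by omega)]
    calc _ = μ.real {ω | ∀ i ∈ Finset.Icc 1 n, Y i ω = v i} * (p / (2 * d)) := by ring
      _ ≤ _ := mul_le_mul_of_nonneg_left (le_transitionMatrix hp1 _ _) measureReal_nonneg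
  | succ k hk ih =>
    -- Both sides gain the same factor, because the update probability is constant from time `2` on.
    rw [hY.markov k hk (fun i => v (n + i)), ← add_assoc n k 1, hY.markov (n + k) (by omega),
      hpseq _ (by omega), hpseq _ (by omega), ← mul_assoc]
    exact mul_le_mul_of_nonneg_right ih
      (le_trans (by positivity) (le_transitionMatrix hp1 _ _))

theorem IsConservativeStepChain.cylinder_flip (hY : IsConservativeStepChain pseq μ Y)
    {n : ℕ} (hn : 1 ≤ n) (v : ℕ → Direction d) :
    μ.real {ω | ∀ i ∈ Finset.Icc 1 n, Y i ω = (v i).flip} =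
      μ.real {ω | ∀ i ∈ Finset.Icc 1 n, Y i ω = v i} := by
  induction n, hn using Nat.le_induction with
  | base => rw [hY.cylinder_one (fun i => (v i).flip), hY.cylinder_one]
  | succ k hk ih =>
    rw [hY.markov k hk (fun i => (v i).flip), hY.markov k hk, transitionMatrix_flip, ih]

theorem IsConservativeStepChain.block_flip (hY : IsConservativeStepChain pseq μ Y)
    {n : ℕ} (hn : 1 ≤ n) (x : Fin n → Direction d) :
    μ.real {ω | stepBlock Y 0 n ω = fun i => (x i).flip} =
      μ.real {ω | stepBlock Y 0 n ω = x} := by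
  obtain ⟨v, rfl, -⟩ := exists_eq_blocks hn x x
  have := setOf_stepBlock_eq Y n (fun i => (v i).flip)
  rw [this, setOf_stepBlock_eq]
  exact hY.cylinder_flip hn v

end Chain

/-! ### From point probabilities to events and expectations -/

theorem measureReal_mem_eq_sum {Ω α : Type*} [MeasurableSpace Ω] [MeasurableSpace α]
    [MeasurableSingletonClass α] {μ : Measure Ω} [IsFiniteMeasure μ] {X : Ω → α}
    (hX : Measurable X) (s : Finset α) :
    μ.real {ω | X ω ∈ s} = ∑ x ∈ s, μ.real {ω | X ω = x} :=
  (sum_measureReal_preimage_singleton s fun y _ => hX (measurableSet_singleton y)).symm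

/-- A domination between point probabilities of finitely valued random variables passes to
events. -/
theorem mul_measureReal_le_of_forall_singleton {Ω α β : Type*} [MeasurableSpace Ω]
    [Finite α] [MeasurableSpace α] [MeasurableSingletonClass α]
    [Finite β] [MeasurableSpace β] [MeasurableSingletonClass β]
    {μ : Measure Ω} [IsFiniteMeasure μ] {X : Ω → α} {Z Z' : Ω → β}
    (hX : Measurable X) (hZ : Measurable Z) (hZ' : Measurable Z') {c : ℝ}
    (h : ∀ x z, c * μ.real {ω | X ω = x} * μ.real {ω | Z' ω = z} ≤
      μ.real {ω | X ω = x ∧ Z ω = z}) (s : Set α) (t : Set β) :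
    c * μ.real {ω | X ω ∈ s} * μ.real {ω | Z' ω ∈ t} ≤ μ.real {ω | X ω ∈ s ∧ Z ω ∈ t} := by
  classical
  have := Fintype.ofFinite α
  have := Fintype.ofFinite β
  have e1 := measureReal_mem_eq_sum (μ := μ) hX s.toFinset
  have e2 := measureReal_mem_eq_sum (μ := μ) hZ' t.toFinset
  have e3 := measureReal_mem_eq_sum (μ := μ) (hX.prodMk hZ) (s.toFinset ×ˢ t.toFinset)
  simp only [Set.mem_toFinset, Finset.mem_product] at e1 e2 e3
  rw [e1, e2, e3, Finset.sum_product, mul_assoc, Finset.sum_mul_sum, Finset.mul_sum]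
  refine Finset.sum_le_sum fun x _ => ?_
  rw [Finset.mul_sum]
  refine Finset.sum_le_sum fun z _ => ?_
  simpa only [Prod.mk.injEq, mul_assoc] using h x z

section Blocks

variable {Ω : Type*} [MeasurableSpace Ω] {d : ℕ} {μ : Measure Ω} [IsProbabilityMeasure μ] {p : ℝ}
  {pseq : ℕ → ℝ} {Y : ℕ → Ω → Direction d}

theorem IsConservativeStepChain.block_superproduct (hY : IsConservativeStepChain pseq μ Y)
    (hpseq : ∀ n, 2 ≤ n → pseq n = p) (hp0 : 0 ≤ p) (hp1 : p ≤ 1) {n k : ℕ} (hn : 1 ≤ n)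
    (hk : 1 ≤ k) (s : Set (Fin n → Direction d)) (t : Set (Fin k → Direction d)) :
    p * μ.real {ω | stepBlock Y 0 n ω ∈ s} * μ.real {ω | stepBlock Y 0 k ω ∈ t} ≤
      μ.real {ω | stepBlock Y 0 n ω ∈ s ∧ stepBlock Y n k ω ∈ t} := by
  refine mul_measureReal_le_of_forall_singleton (hY.measurable_stepBlock 0 n)
    (hY.measurable_stepBlock n k) (hY.measurable_stepBlock 0 k) (fun x z => ?_) s t
  obtain ⟨v, rfl, rfl⟩ := exists_eq_blocks hk x z
  have := setOf_stepBlock_eq Y k (fun i => v (n + i))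
  simp only [← add_assoc] at this
  rw [setOf_stepBlock_eq, setOf_stepBlock_eq_and, this]
  exact hY.cylinder_superproduct hpseq hp0 hp1 hn hk v

/-- The walk started at the origin is symmetric. -/
theorem IsConservativeStepChain.walk_neg (hY : IsConservativeStepChain pseq μ Y)
    {n : ℕ} (hn : 1 ≤ n) (x : Fin d → ℤ) :
    μ.real {ω | conservativeWalk (0 : Fin d → ℤ) Y n ω = -x} =
      μ.real {ω | conservativeWalk (0 : Fin d → ℤ) Y n ω = x} := by
  classical
  have key : ∀ z : Fin d → ℤ, μ.real {ω | conservativeWalk (0 : Fin d → ℤ) Y n ω = z} =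
      ∑ y : Fin n → Direction d with partialSum n y = z, μ.real {ω | stepBlock Y 0 n ω = y} := by
    intro z
    rw [← measureReal_mem_eq_sum (hY.measurable_stepBlock 0 n)]
    simp [conservativeWalk_eq_partialSum Y le_rfl]
  rw [key, key]
  refine Finset.sum_nbij' (fun y i => (y i).flip) (fun y i => (y i).flip) ?_ ?_ ?_ ?_ ?_
  · intro y hy
    simp_all [partialSum_flip]
  · intro y hy
    simp_all [partialSum_flip]
  · intro y _
    simp [Direction.flip_flip]
  · intro y _
    simp [Direction.flip_flip]
  · intro y _
    exact (hY.block_flip hn y).symm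

/-- Return probabilities are bounded below by collision probabilities. -/
theorem IsConservativeStepChain.mul_sum_sq_le_return (hY : IsConservativeStepChain pseq μ Y)
    (hpseq : ∀ n, 2 ≤ n → pseq n = p) (hp0 : 0 ≤ p) (hp1 : p ≤ 1) {n : ℕ} (hn : 1 ≤ n)
    (B : Finset (Fin d → ℤ)) :
    p * ∑ x ∈ B, μ.real {ω | conservativeWalk (0 : Fin d → ℤ) Y n ω = x} ^ 2 ≤
      μ.real {ω | conservativeWalk (0 : Fin d → ℤ) Y (n + n) ω = 0} := by
  have hm := hY.measurable_walk
  calc p * ∑ x ∈ B, μ.real {ω | conservativeWalk (0 : Fin d → ℤ) Y n ω = x} ^ 2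
      ≤ ∑ x ∈ B, μ.real {ω | conservativeWalk (0 : Fin d → ℤ) Y n ω = x ∧
          conservativeWalk (0 : Fin d → ℤ) Y (n + n) ω = 0} := by
        rw [Finset.mul_sum]
        refine Finset.sum_le_sum fun x _ => ?_
        have h := hY.block_superproduct hpseq hp0 hp1 hn hn {y | partialSum n y = x}
          {y | partialSum n y = -x}
        simp only [Set.mem_ofPred_eq, ← conservativeWalk_eq_partialSum Y le_rfl] at h
        -- Symmetry turns the product of the probabilities of `x` and `-x` into a square.
        rw [hY.walk_neg hn] at h
        calc _ = _ := by ring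
          _ ≤ _ := h
          _ ≤ _ := by
            refine measureReal_mono fun ω hω => ⟨hω.1, ?_⟩
            rw [conservativeWalk_add Y n le_rfl, hω.1, hω.2, add_neg_cancel]
    _ = μ.real (⋃ x ∈ B, {ω | conservativeWalk (0 : Fin d → ℤ) Y n ω = x ∧
          conservativeWalk (0 : Fin d → ℤ) Y (n + n) ω = 0}) := by
        rw [measureReal_biUnion_finset]
        · intro x _ y _ hxy
          exact Set.disjoint_left.2 fun ω h1 h2 => hxy (h1.1.symm.trans h2.1)
        · intro x _
          exact (hm n (measurableSet_singleton x)).inter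
            (hm (n + n) (measurableSet_singleton 0))
    _ ≤ _ := measureReal_mono (Set.iUnion₂_subset fun x _ ω h => h.2)

/-- Condition on the past: a mean-zero function of the next direction has conditional expectation `1
- pseq (n + 2)` times its current value. -/
theorem IsConservativeStepChain.integral_block_mul_step (hY : IsConservativeStepChain pseq μ Y)
    {n : ℕ} (f : (Fin (n + 1) → Direction d) → ℝ) (g : Direction d → ℝ)
    (hg : ∑ v, g v = 0) :
    ∫ ω, f (stepBlock Y 0 (n + 1) ω) * g (Y (n + 2) ω) ∂μ =
      (1 - pseq (n + 2)) * ∫ ω, f (stepBlock Y 0 (n + 1) ω) * g (Y (n + 1) ω) ∂μ := by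
  have hX := hY.measurable_stepBlock 0 (n + 1)
  have hZ : Measurable fun ω => (stepBlock Y 0 (n + 1) ω, Y (n + 2) ω) :=
    hX.prodMk (hY.measurable _ (by omega))
  have e1 : ∫ ω, f (stepBlock Y 0 (n + 1) ω) * g (Y (n + 2) ω) ∂μ =
      ∑ x, ∑ v, μ.real {ω | stepBlock Y 0 (n + 1) ω = x ∧ Y (n + 2) ω = v} * (f x * g v) := by
    rw [← integral_map (φ := fun ω => (stepBlock Y 0 (n + 1) ω, Y (n + 2) ω))
      (f := fun z => f z.1 * g z.2) hZ.aemeasurable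
      (measurable_of_countable _).aestronglyMeasurable]
    have := Measure.isProbabilityMeasure_map (μ := μ) hZ.aemeasurable
    rw [integral_fintype .of_finite, Fintype.sum_prod_type]
    refine Finset.sum_congr rfl fun x _ => Finset.sum_congr rfl fun v _ => ?_
    rw [map_measureReal_apply hZ (measurableSet_singleton _), smul_eq_mul]
    congr 2
    ext ω
    simp
  have e2 : ∫ ω, f (stepBlock Y 0 (n + 1) ω) * g (Y (n + 1) ω) ∂μ =
      ∑ x, μ.real {ω | stepBlock Y 0 (n + 1) ω = x} * (f x * g (x (Fin.last n))) := by
    have : ∀ ω, Y (n + 1) ω = stepBlock Y 0 (n + 1) ω (Fin.last n) := fun ω => by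
      simp [stepBlock]
    simp only [this]
    rw [← integral_map (φ := stepBlock Y 0 (n + 1))
      (f := fun z => f z * g (z (Fin.last n))) hX.aemeasurable
      (measurable_of_countable _).aestronglyMeasurable]
    have := Measure.isProbabilityMeasure_map (μ := μ) hX.aemeasurable
    rw [integral_fintype .of_finite]
    refine Finset.sum_congr rfl fun x _ => ?_
    rw [map_measureReal_apply hX (measurableSet_singleton _), smul_eq_mul]
    rfl
  rw [e1, e2, Finset.mul_sum]
  refine Finset.sum_congr rfl fun x _ => ?_
  have e3 : ∀ v, μ.real {ω | stepBlock Y 0 (n + 1) ω = x ∧ Y (n + 2) ω = v} =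
      μ.real {ω | stepBlock Y 0 (n + 1) ω = x} *
        transitionMatrix d (pseq (n + 2)) (x (Fin.last n)) v := by
    intro v
    obtain ⟨w, rfl, hw⟩ := exists_eq_blocks (k := 1) le_rfl x (fun _ => v)
    have hv : v = w (n + 2) := by simpa using congrFun hw 0
    have h := setOf_stepBlock_eq_and Y (n + 1) 1 w
    rw [setOf_stepBlock_eq, hv]
    convert hY.markov (n + 1) (by omega) w using 2
    · rw [← h]
      ext ω
      simp [funext_iff, stepBlock]
    · simp
  calc _ = μ.real {ω | stepBlock Y 0 (n + 1) ω = x} * f x *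
        ∑ v, transitionMatrix d (pseq (n + 2)) (x (Fin.last n)) v * g v := by
        rw [Finset.mul_sum]
        refine Finset.sum_congr rfl fun v _ => ?_
        rw [e3]
        ring
    _ = _ := by
        rw [sum_transitionMatrix_mul _ _ _ hg]
        ring

end Blocks
-- Second moment of the walk
section Variance

variable {Ω : Type*} [MeasurableSpace Ω] {d : ℕ} {μ : Measure Ω} [IsProbabilityMeasure μ] {p : ℝ}
  {pseq : ℕ → ℝ} {Y : ℕ → Ω → Direction d}

theorem IsConservativeStepChain.integrable_comp_stepBlock
    (hY : IsConservativeStepChain pseq μ Y) (n k : ℕ) (f : (Fin k → Direction d) → ℝ) :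
    Integrable (fun ω => f (stepBlock Y n k ω)) μ := by
  have := Measure.isProbabilityMeasure_map (μ := μ) (hY.measurable_stepBlock n k).aemeasurable
  exact (Integrable.of_finite (μ := μ.map (stepBlock Y n k)) (f := f)).comp_measurable
    (hY.measurable_stepBlock n k)

theorem IsConservativeStepChain.integrable_walk_step (hY : IsConservativeStepChain pseq μ Y)
    (n : ℕ) (f : (Fin d → ℤ) → Direction d → ℝ) :
    Integrable (fun ω => f (conservativeWalk 0 Y n ω) (Y (n + 1) ω)) μ := by
  have h := hY.integrable_comp_stepBlock 0 (n + 1)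
    (fun x => f (partialSum n x) (x (Fin.last n)))
  refine h.congr (.of_forall fun ω => ?_)
  simp [conservativeWalk_eq_partialSum Y (Nat.le_succ n), stepBlock]

theorem conservativeWalk_succ {Ω : Type*} {d : ℕ} (Y : ℕ → Ω → Direction d) (n : ℕ) (ω : Ω) :
    conservativeWalk (0 : Fin d → ℤ) Y (n + 1) ω =
      conservativeWalk (0 : Fin d → ℤ) Y n ω + (Y (n + 1) ω).toVec := by
  rw [conservativeWalk_zero_eq, conservativeWalk_zero_eq, Finset.sum_range_succ]

theorem IsConservativeStepChain.integral_step_sq_le (hY : IsConservativeStepChain pseq μ Y)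
    (i : Fin d) (n : ℕ) : ∫ ω, ((Y (n + 1) ω).toVec i : ℝ) ^ 2 ∂μ ≤ 1 := by
  calc _ ≤ ∫ _, (1 : ℝ) ∂μ :=
        integral_mono (hY.integrable_walk_step n fun _ v => (v.toVec i : ℝ) ^ 2)
          (integrable_const _) fun ω => (Y (n + 1) ω).toVec_apply_sq_le i
    _ = 1 := by simp

theorem IsConservativeStepChain.integral_walk_mul_next_step
    (hY : IsConservativeStepChain pseq μ Y) (hpseq : ∀ n, 2 ≤ n → pseq n = p) (i : Fin d) (n : ℕ) :
    ∫ ω, (conservativeWalk (0 : Fin d → ℤ) Y (n + 1) ω i : ℝ) * (Y (n + 2) ω).toVec i ∂μ =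
      (1 - p) *
        ∫ ω, (conservativeWalk (0 : Fin d → ℤ) Y (n + 1) ω i : ℝ) * (Y (n + 1) ω).toVec i ∂μ := by
  simp only [conservativeWalk_eq_partialSum Y (le_refl (n + 1))]
  rw [hY.integral_block_mul_step (fun x => (partialSum (n + 1) x i : ℝ)) (fun v => v.toVec i)
    (Direction.sum_toVec_apply i), hpseq _ (by omega)]

/-- The correlations satisfy `a_{n+1} ≤ (1 - p) a_n + 1`, and `1 / p` is the fixed point of this
recursion. -/
theorem IsConservativeStepChain.integral_walk_mul_step_le (hY : IsConservativeStepChain pseq μ Y)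
    (hpseq : ∀ n, 2 ≤ n → pseq n = p) (hp0 : 0 < p) (hp1 : p ≤ 1) (i : Fin d) (n : ℕ) :
    ∫ ω, (conservativeWalk (0 : Fin d → ℤ) Y (n + 1) ω i : ℝ) * (Y (n + 1) ω).toVec i ∂μ ≤
      1 / p := by
  have split : ∀ n, ∫ ω, (conservativeWalk (0 : Fin d → ℤ) Y (n + 1) ω i : ℝ) *
        (Y (n + 1) ω).toVec i ∂μ =
      ∫ ω, (conservativeWalk (0 : Fin d → ℤ) Y n ω i : ℝ) * (Y (n + 1) ω).toVec i ∂μ +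
        ∫ ω, ((Y (n + 1) ω).toVec i : ℝ) ^ 2 ∂μ := by
    intro n
    rw [← integral_add (hY.integrable_walk_step n fun s v => (s i : ℝ) * v.toVec i)
      (hY.integrable_walk_step n fun _ v => (v.toVec i : ℝ) ^ 2)]
    congr 1 with ω
    rw [conservativeWalk_succ, Pi.add_apply]
    push_cast
    ring
  induction n with
  | zero =>
    rw [split]
    have h := hY.integral_step_sq_le i 0
    have : 1 ≤ 1 / p := by rw [le_div_iff₀ hp0]; linarith
    simp only [conservativeWalk_zero_eq, Finset.range_zero, Finset.sum_empty, Pi.zero_apply,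
      Int.cast_zero, zero_mul, integral_zero]
    linarith
  | succ n ih =>
    rw [split, hY.integral_walk_mul_next_step hpseq]
    have h := hY.integral_step_sq_le i (n + 1)
    have h2 := mul_le_mul_of_nonneg_left ih (sub_nonneg.2 hp1)
    have h3 : (1 - p) * (1 / p) + 1 = 1 / p := by field_simp; ring
    linarith

/-- The walk is diffusive. -/
theorem IsConservativeStepChain.integral_walk_sq_le (hY : IsConservativeStepChain pseq μ Y)
    (hpseq : ∀ n, 2 ≤ n → pseq n = p) (hp0 : 0 < p) (hp1 : p ≤ 1) (i : Fin d) (n : ℕ) :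
    ∫ ω, (conservativeWalk (0 : Fin d → ℤ) Y n ω i : ℝ) ^ 2 ∂μ ≤ 2 / p * n := by
  have split : ∀ n, ∫ ω, (conservativeWalk (0 : Fin d → ℤ) Y (n + 1) ω i : ℝ) ^ 2 ∂μ =
      ∫ ω, (conservativeWalk (0 : Fin d → ℤ) Y n ω i : ℝ) ^ 2 ∂μ +
      2 * ∫ ω, (conservativeWalk (0 : Fin d → ℤ) Y n ω i : ℝ) * (Y (n + 1) ω).toVec i ∂μ +
        ∫ ω, ((Y (n + 1) ω).toVec i : ℝ) ^ 2 ∂μ := by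
    intro n
    have h1 := hY.integrable_walk_step n fun s _ => (s i : ℝ) ^ 2
    have h2 := hY.integrable_walk_step n fun s v => (s i : ℝ) * v.toVec i
    rw [← integral_const_mul, ← integral_add h1 (h2.const_mul 2),
      ← integral_add (h1.fun_add (h2.const_mul 2))
      (hY.integrable_walk_step n fun _ v => (v.toVec i : ℝ) ^ 2)]
    congr 1 with ω
    rw [conservativeWalk_succ, Pi.add_apply]
    push_cast
    ring
  induction n with
  | zero => simp [conservativeWalk_zero_eq]
  | succ n ih =>
    rw [split]
    have h := hY.integral_step_sq_le i n
    -- The increment of the second moment is at most `2 (1 - p) / p + 1 = 2 / p - 1`.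
    have h1 : 1 / p = 1 + (1 - p) * (1 / p) := by field_simp; ring
    have h2 : 1 ≤ 1 / p := by rw [le_div_iff₀ hp0]; linarith
    have h3 : ∫ ω, (conservativeWalk (0 : Fin d → ℤ) Y n ω i : ℝ) * (Y (n + 1) ω).toVec i ∂μ ≤
        (1 - p) * (1 / p) := by
      cases n with
      | zero =>
        simp only [conservativeWalk_zero_eq, Finset.range_zero, Finset.sum_empty, Pi.zero_apply,
          Int.cast_zero, zero_mul, integral_zero]
        exact mul_nonneg (sub_nonneg.2 hp1) (by positivity)
      | succ n =>
        rw [hY.integral_walk_mul_next_step hpseq]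
        exact mul_le_mul_of_nonneg_left (hY.integral_walk_mul_step_le hpseq hp0 hp1 i n)
          (sub_nonneg.2 hp1)
    have h4 : 2 / p = 2 * (1 / p) := by ring
    push_cast
    rw [h4] at ih ⊢
    linarith

/-- Chebyshev's inequality; the walk is integer-valued, so exceeding `M` means reaching `M + 1`. -/
theorem IsConservativeStepChain.sq_mul_measureReal_lt_abs_walk_le
    (hY : IsConservativeStepChain pseq μ Y)
    (hpseq : ∀ n, 2 ≤ n → pseq n = p) (hp0 : 0 < p) (hp1 : p ≤ 1) (i : Fin d) (n M : ℕ) :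
    ((M : ℝ) + 1) ^ 2 * μ.real {ω | (M : ℤ) < |conservativeWalk (0 : Fin d → ℤ) Y n ω i|} ≤
      2 / p * n := by
  refine le_trans ?_ (hY.integral_walk_sq_le hpseq hp0 hp1 i n)
  refine le_trans ?_ (mul_meas_ge_le_integral_of_nonneg
    (f := fun ω => (conservativeWalk (0 : Fin d → ℤ) Y n ω i : ℝ) ^ 2)
    (.of_forall fun ω => sq_nonneg _)
    (hY.integrable_walk_step n fun s _ => (s i : ℝ) ^ 2) (((M : ℝ) + 1) ^ 2))
  refine mul_le_mul_of_nonneg_left (measureReal_mono fun ω hω => ?_) (sq_nonneg _)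
  have h : ((M : ℤ) + 1 : ℝ) ≤ (|conservativeWalk (0 : Fin d → ℤ) Y n ω i| : ℤ) := by
    exact_mod_cast hω
  rw [Set.mem_ofPred_eq, ← sq_abs (conservativeWalk (0 : Fin d → ℤ) Y n ω i : ℝ)]
  push_cast at h
  gcongr

end Variance

/-! ### Return probabilities in the plane -/

section Planar

variable {Ω : Type*} [MeasurableSpace Ω] {μ : Measure Ω} [IsProbabilityMeasure μ] {p : ℝ}
  {pseq : ℕ → ℝ} {Y : ℕ → Ω → Direction 2}

theorem IsConservativeStepChain.half_le_measureReal_box (hY : IsConservativeStepChain pseq μ Y)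
    (hpseq : ∀ n, 2 ≤ n → pseq n = p) (hp0 : 0 < p) (hp1 : p ≤ 1) {n M : ℕ}
    (hM : 8 / p * n ≤ ((M : ℝ) + 1) ^ 2) :
    1 / 2 ≤ μ.real {ω | conservativeWalk (0 : Fin 2 → ℤ) Y n ω ∈
      Fintype.piFinset fun _ => Finset.Icc (-M : ℤ) M} := by
  set B := {ω | conservativeWalk (0 : Fin 2 → ℤ) Y n ω ∈
      Fintype.piFinset fun _ => Finset.Icc (-M : ℤ) M} with hB
  have hBm : MeasurableSet B :=
    hY.measurable_walk n (Finset.measurableSet (Fintype.piFinset fun _ => Finset.Icc (-M : ℤ) M))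
  have h1 : μ.real Bᶜ ≤ ∑ i : Fin 2,
      μ.real {ω | (M : ℤ) < |conservativeWalk (0 : Fin 2 → ℤ) Y n ω i|} := by
    refine le_trans (measureReal_mono fun ω hω => ?_) (measureReal_iUnion_fintype_le _)
    by_contra hc
    simp only [Set.mem_iUnion, Set.mem_ofPred_eq, not_exists, not_lt, abs_le] at hc
    exact hω (Fintype.mem_piFinset.2 fun i => Finset.mem_Icc.2 (hc i))
  have h2 : ∀ i : Fin 2,
      μ.real {ω | (M : ℤ) < |conservativeWalk (0 : Fin 2 → ℤ) Y n ω i|} ≤ 1 / 4 := by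
    intro i
    have h := hY.sq_mul_measureReal_lt_abs_walk_le hpseq hp0 hp1 i n M
    have h4 : 2 / p * n = 1 / 4 * (8 / p * n) := by ring
    have : (0 : ℝ) < ((M : ℝ) + 1) ^ 2 := by positivity
    refine le_of_mul_le_mul_left ?_ this
    linarith
  rw [probReal_compl_eq_one_sub hBm, Fin.sum_univ_two] at h1
  linarith [h2 0, h2 1]

theorem IsConservativeStepChain.exists_div_le_return (hY : IsConservativeStepChain pseq μ Y)
    (hpseq : ∀ n, 2 ≤ n → pseq n = p) (hp0 : 0 < p) (hp1 : p ≤ 1) :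
    ∃ c : ℝ, 0 < c ∧ ∀ n : ℕ, 1 ≤ n →
      c / n ≤ μ.real {ω | conservativeWalk (0 : Fin 2 → ℤ) Y (n + n) ω = 0} := by
  obtain ⟨K, hK⟩ := exists_nat_ge (8 / p)
  have hK0 : (0 : ℝ) < K := lt_of_lt_of_le (by positivity) hK
  -- The box has at most `9 K n` points and mass at least `1/2`, so the sum of squares is at least
  -- `1 / (36 K n)`.
  refine ⟨p / (36 * K), by positivity, fun n hn => ?_⟩
  have hn' : (1 : ℝ) ≤ n := by exact_mod_cast hn
  set M := Nat.sqrt (K * n) with hMdef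
  have hlow : 8 / p * n ≤ ((M : ℝ) + 1) ^ 2 := by
    have : K * n ≤ (M + 1) ^ 2 := (Nat.lt_succ_sqrt' (K * n)).le
    calc 8 / p * n ≤ K * n := by gcongr
      _ ≤ _ := by exact_mod_cast this
  set B : Finset (Fin 2 → ℤ) := Fintype.piFinset fun _ => Finset.Icc (-M : ℤ) M with hB
  have hcard : (B.card : ℝ) ≤ 9 * (K * n) := by
    have h1 : B.card = (2 * M + 1) ^ 2 := by
      rw [hB, Fintype.card_piFinset]
      simp only [Int.card_Icc, Finset.prod_const, Finset.card_univ, Fintype.card_fin]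
      congr 1
      omega
    have h2 : M ^ 2 ≤ K * n := Nat.sqrt_le' _
    have h3 : 1 ≤ K * n := Nat.mul_pos (by exact_mod_cast hK0) hn
    have h4 : M ≤ M ^ 2 := Nat.le_self_pow two_ne_zero M
    -- Each of `M^2`, `M` and `1` is at most `K n` in `4 M^2 + 4 M + 1`.
    have : B.card ≤ 9 * (K * n) := by rw [h1]; nlinarith
    exact_mod_cast this
  have hbox := hY.half_le_measureReal_box hpseq hp0 hp1 hlow
  rw [← hB, measureReal_mem_eq_sum (hY.measurable_walk n)] at hbox
  have hcs := sq_sum_le_card_mul_sum_sq (s := B)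
    (f := fun x => μ.real {ω | conservativeWalk (0 : Fin 2 → ℤ) Y n ω = x})
  have hret := hY.mul_sum_sq_le_return hpseq hp0.le hp1 hn B
  set T := ∑ x ∈ B, μ.real {ω | conservativeWalk (0 : Fin 2 → ℤ) Y n ω = x} ^ 2
  have hT : 0 ≤ T := Finset.sum_nonneg fun _ _ => sq_nonneg _
  have h1 : 1 / 4 ≤ 9 * (K * n) * T := by
    calc (1 : ℝ) / 4 = (1 / 2) ^ 2 := by norm_num
      _ ≤ _ := pow_le_pow_left₀ (by norm_num) hbox 2
      _ ≤ _ := hcs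
      _ ≤ _ := mul_le_mul_of_nonneg_right hcard hT
  refine le_trans ?_ hret
  rw [div_div, div_le_iff₀ (by positivity)]
  nlinarith

theorem IsConservativeStepChain.not_summable_return (hY : IsConservativeStepChain pseq μ Y)
    (hpseq : ∀ n, 2 ≤ n → pseq n = p) (hp0 : 0 < p) (hp1 : p ≤ 1) :
    ¬ Summable fun n => μ.real {ω | conservativeWalk (0 : Fin 2 → ℤ) Y n ω = 0} := by
  intro hs
  obtain ⟨c, hc, h⟩ := hY.exists_div_le_return hpseq hp0 hp1
  have h1 := hs.comp_injective (i := fun n : ℕ => (n + 1) + (n + 1)) fun a b hab => by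
    simp only at hab
    omega
  have h2 : Summable fun n : ℕ => c / ((n + 1 : ℕ) : ℝ) :=
    Summable.of_nonneg_of_le (fun n => by positivity) (fun n => h (n + 1) (by omega)) h1
  rw [summable_nat_add_iff (f := fun n : ℕ => c / (n : ℝ)) 1] at h2
  refine Real.not_summable_one_div_natCast ((h2.mul_left c⁻¹).congr fun n => ?_)
  field_simp

end Planar

/-! ### From infinitely many expected returns to recurrence -/

/-- Among the times in a window of length `N`, at most `m + 1` are visited and followed by no visit
in `(n + m, n + N + 1]`. -/
theorem card_filter_isolated_le (m N : ℕ) (V : ℕ → Prop) [DecidablePred fun n => V n ∧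
    ∀ j ∈ Finset.Ioc m (N + 1), ¬ V (n + j)] :
    ((Finset.Icc 1 N).filter fun n => V n ∧ ∀ j ∈ Finset.Ioc m (N + 1), ¬ V (n + j)).card ≤
      m + 1 := by
  set s := (Finset.Icc 1 N).filter fun n => V n ∧ ∀ j ∈ Finset.Ioc m (N + 1), ¬ V (n + j)
    with hs
  rcases s.eq_empty_or_nonempty with h | h
  · simp [h]
  have hmin := s.min'_mem h
  set a := s.min' h with ha
  have hsub : s ⊆ Finset.Icc a (a + m) := by
    intro b hb
    have hab : a ≤ b := s.min'_le b hb
    rw [hs, Finset.mem_filter, Finset.mem_Icc] at hmin hb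
    refine Finset.mem_Icc.2 ⟨hab, ?_⟩
    by_contra! hlt
    -- A later element `b > a + m` would itself be a visit forbidden by the earliest element `a`.
    refine hmin.2.2 (b - a) (Finset.mem_Ioc.2 ⟨by omega, by omega⟩) ?_
    rw [Nat.add_sub_cancel' hab]
    exact hb.2.1
  refine (Finset.card_le_card hsub).trans ?_
  rw [Nat.card_Icc]
  omega

section Recurrence

variable {Ω : Type*} [MeasurableSpace Ω] {d : ℕ} {μ : Measure Ω} [IsProbabilityMeasure μ] {p : ℝ}
  {pseq : ℕ → ℝ} {Y : ℕ → Ω → Direction d}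

theorem sum_measureReal_le_of_card_le {ι : Type*} (s : Finset ι) (E : ι → Set Ω)
    (hE : ∀ i, MeasurableSet (E i)) [∀ ω, DecidablePred fun i => ω ∈ E i] {m : ℕ}
    (h : ∀ ω, (s.filter fun i => ω ∈ E i).card ≤ m) : ∑ i ∈ s, μ.real (E i) ≤ m := by
  calc ∑ i ∈ s, μ.real (E i) = ∫ ω, ∑ i ∈ s, (E i).indicator (fun _ => (1 : ℝ)) ω ∂μ := by
        rw [integral_finsetSum _ fun i _ => (integrable_const (1 : ℝ)).indicator (hE i)]
        refine Finset.sum_congr rfl fun i _ => ?_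
        rw [integral_indicator (hE i)]
        simp
    _ ≤ ∫ _, (m : ℝ) ∂μ := by
        refine integral_mono (integrable_finsetSum _ fun i _ =>
          (integrable_const (1 : ℝ)).indicator (hE i)) (integrable_const _) fun ω => ?_
        simp only [Set.indicator_apply, Finset.sum_boole]
        exact_mod_cast h ω
    _ = m := by simp

/-- If the expected number of returns is infinite, then almost surely there are visits to the
origin after any given time. -/
theorem IsConservativeStepChain.measureReal_no_visit_after (hY : IsConservativeStepChain pseq μ Y)
    (hpseq : ∀ n, 2 ≤ n → pseq n = p) (hp0 : 0 < p) (hp1 : p ≤ 1)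
    (hns : ¬ Summable fun n => μ.real {ω | conservativeWalk (0 : Fin d → ℤ) Y n ω = 0}) (m : ℕ) :
    μ.real {ω | ∀ j, m < j → conservativeWalk (0 : Fin d → ℤ) Y j ω ≠ 0} = 0 := by
  classical
  set t := μ.real {ω | ∀ j, m < j → conservativeWalk (0 : Fin d → ℤ) Y j ω ≠ 0} with ht
  by_contra hne
  have htpos : 0 < t := lt_of_le_of_ne measureReal_nonneg (Ne.symm hne)
  have hzero : ∀ n, MeasurableSet {ω | conservativeWalk (0 : Fin d → ℤ) Y n ω = 0} := fun n =>
    hY.measurable_walk n (measurableSet_singleton 0)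
  have key : ∀ N, ∑ n ∈ Finset.Icc 1 N,
      p * μ.real {ω | conservativeWalk (0 : Fin d → ℤ) Y n ω = 0} * t ≤ (m + 1 : ℕ) := by
    intro N
    let E : ℕ → Set Ω := fun n => {ω | conservativeWalk (0 : Fin d → ℤ) Y n ω = 0 ∧
      ∀ j ∈ Finset.Ioc m (N + 1), ¬ conservativeWalk (0 : Fin d → ℤ) Y (n + j) ω = 0}
    have hE : ∀ n, MeasurableSet (E n) := fun n => by
      have e : E n = {ω | conservativeWalk (0 : Fin d → ℤ) Y n ω = 0} ∩
          ⋂ j ∈ Finset.Ioc m (N + 1),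
            {ω | conservativeWalk (0 : Fin d → ℤ) Y (n + j) ω = 0}ᶜ := by
        ext ω
        simp [E]
      rw [e]
      exact (hzero n).inter
        (Finset.measurableSet_biInter _ fun j _ => (hzero (n + j)).compl)
    refine le_trans (Finset.sum_le_sum fun n hn => ?_)
      (sum_measureReal_le_of_card_le (μ := μ) (Finset.Icc 1 N) E hE fun ω =>
        card_filter_isolated_le m N fun n => conservativeWalk (0 : Fin d → ℤ) Y n ω = 0)
    -- The second block has length `N + 1`, hence is nonempty even for `N = 0`.
    have h := hY.block_superproduct hpseq hp0.le hp1 (Finset.mem_Icc.1 hn).1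
      (Nat.succ_pos N) {y | partialSum n y = 0}
      {y | ∀ j ∈ Finset.Ioc m (N + 1), ¬ partialSum j y = 0}
    simp only [Set.mem_ofPred_eq, ← conservativeWalk_eq_partialSum Y le_rfl] at h
    refine le_trans (mul_le_mul_of_nonneg_left ?_ (by positivity)) (h.trans ?_)
    · refine measureReal_mono fun ω hω j hj => ?_
      rw [Finset.mem_Ioc] at hj
      rw [← conservativeWalk_eq_partialSum Y hj.2]
      exact hω j hj.1
    · refine measureReal_mono fun ω hω => ⟨hω.1, fun j hj => ?_⟩
      rw [conservativeWalk_add Y n (Finset.mem_Ioc.1 hj).2, hω.1, zero_add]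
      exact hω.2 j hj
  -- Dividing `key` by `p * t` bounds all partial sums of the return probabilities.
  refine hns ((summable_nat_add_iff 1).1 (summable_of_sum_range_le (c := (m + 1 : ℕ) / (p * t))
    (fun n => measureReal_nonneg) fun N => ?_))
  have h := key N
  rw [← Finset.sum_mul, ← Finset.mul_sum] at h
  rw [le_div_iff₀ (by positivity)]
  have e : ∑ n ∈ Finset.range N, μ.real {ω | conservativeWalk (0 : Fin d → ℤ) Y (n + 1) ω = 0} =
      ∑ n ∈ Finset.Icc 1 N, μ.real {ω | conservativeWalk (0 : Fin d → ℤ) Y n ω = 0} := by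
    rw [Finset.range_eq_Ico, Finset.sum_Ico_add'
      (fun n => μ.real {ω | conservativeWalk (0 : Fin d → ℤ) Y n ω = 0})]
    rfl
  rw [e]
  linarith

theorem IsConservativeStepChain.isRecurrentWalk (hY : IsConservativeStepChain pseq μ Y)
    (hpseq : ∀ n, 2 ≤ n → pseq n = p) (hp0 : 0 < p) (hp1 : p ≤ 1)
    (hns : ¬ Summable fun n => μ.real {ω | conservativeWalk (0 : Fin d → ℤ) Y n ω = 0}) :
    IsRecurrentWalk μ (conservativeWalk (0 : Fin d → ℤ) Y) := by
  have h : ∀ m : ℕ, ∀ᵐ ω ∂μ, ¬ ∀ j, m < j → conservativeWalk (0 : Fin d → ℤ) Y j ω ≠ 0 := by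
    intro m
    rw [ae_iff]
    simp only [not_not]
    exact (measureReal_eq_zero_iff).1 (hY.measureReal_no_visit_after hpseq hp0 hp1 hns m)
  filter_upwards [ae_all_iff.2 h] with ω hω
  rw [frequently_atTop']
  intro m
  have := hω m
  push Not at this
  exact this

end Recurrence

theorem theorem1 {Ω : Type*} [MeasurableSpace Ω] (μ : Measure Ω) [IsProbabilityMeasure μ]
    (p : ℝ) (hp0 : 0 < p) (hp1 : p < 1)
    (pseq : ℕ → ℝ) (hpseq : ∀ n, 2 ≤ n → pseq n = p)
    (Y : ℕ → Ω → Direction 2) (hY : IsConservativeStepChain pseq μ Y) :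
    IsRecurrentWalk μ (conservativeWalk (0 : Fin 2 → ℤ) Y) :=
  hY.isRecurrentWalk hpseq hp0 hp1.le (hY.not_summable_return hpseq hp0 hp1.le)
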